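/- Let $\Omega\subset\mathbb R^2$ be an open set (in particular, $\Omega$ may be any bounded polygonal domain with Lipschitz boundary), let $T>0$, and let $H_0^1(\Omega)$ be the closure of $C_c^\infty(\Omega)$ in the norm $\|w\|_1=(\|w\|^2+\|\nabla w\|^2)^{1/2}$, where $(\cdot,\cdot)$ and $\|\cdot\|$ are the inner product and norm of $L^2(\Omega)$. Assume: * $\boldsymbol\mu,\boldsymbol\epsilon\in[L^\infty(\Omega)]^{2\times2}$ are symmetric, and there is a constant $\underline M>0$ such that $\boldsymbol\xi^T\boldsymbol\mu(\boldsymbol x)\boldsymbol\xi\ge\underline M|\boldsymbol\xi|^2$ and $\boldsymbol\xi^T\boldsymbol\epsilon(\boldsymbol x)\boldsymbol\xi\ge\underline M|\boldsymbol\xi|^2$ for all $\boldsymbol\xi\in\mathbb R^2$ and almost every $\boldsymbol x\in\Omega$; * $\gamma\in L^\infty(\Omega)$, $\boldsymbol\beta\in[L^\infty(\Omega)]^2$, and the distributional divergence $\nabla\cdot\boldsymbol\beta$ belongs to $L^\infty(\Omega)$; * there is a constant $\sigma_0\ge0$ such that $\sigma:=\gamma-\frac12\nabla\cdot\boldsymbol\beta\ge\sigma_0$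 almost everywhere in $\Omega$; * $f\in L^2(0,T;L^2(\Omega))$ and $u_0\in H_0^1(\Omega)$. For $w,v\in H_0^1(\Omega)$ put $$m_1(w,v)=(w,v),\qquad m_2(w,v)=(\boldsymbol\mu\nabla w,\nabla v),$$ $$a(w,v)=(\boldsymbol\epsilon\nabla w,\nabla v)+(\sigma w,v),\qquad b(w,v)=\tfrac12\big[(\boldsymbol\beta\cdot\nabla w,v)-(w,\boldsymbol\beta\cdot\nabla v)\big].$$ A *weak solution* is a $u\in L^2(0,T;H_0^1(\Omega))$ with weak time derivative $u_t\in L^1(0,T;H_0^1(\Omega))$ such that, for almost every $t\in(0,T]$, $$m_1(u_t(t),v)+m_2(u_t(t),v)+a(u(t),v)+b(u(t),v)=(f(t),v)\qquad\text{for all }v\in H_0^1(\Omega),$$ and such that the continuous representative $[0,T]\to H_0^1(\Omega)$ of $u$ takes the value $u_0$ at $t=0$. Then there is exactly one weak solution $u$ in $L^2(0,T;H_0^1(\Omega))$. Moreover, its time derivative satisfies $u_t\in L^2(0,T;H_0^1(\Omega))$. -/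

import Mathlib

open MeasureTheory Set TopologicalSpace Matrix
open scoped Distributions Gradient ENNReal ContDiff

noncomputable section

namespace SobolevEq

/-- The Euclidean plane `ℝ²`. -/
abbrev Plane : Type := EuclideanSpace ℝ (Fin 2)

/-- `L²(Ω)`. -/
abbrev L2 (Ω : Opens Plane) : Type := Lp ℝ 2 (volume.restrict (Ω : Set Plane))

/-- `L²(Ω)²`, the space of square integrable vector fields. -/
abbrev L2Vec (Ω : Opens Plane) : Type := Lp Plane 2 (volume.restrict (Ω : Set Plane))

/-- The Hilbert space `L²(Ω) × L²(Ω)²` with `‖(w, g)‖² = ‖w‖² + ‖g‖²`. On a pair `(w, ∇w)` this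
is the `H¹(Ω)` norm. -/
abbrev GraphSpace (Ω : Opens Plane) : Type := WithLp 2 (L2 Ω × L2Vec Ω)

/-- The pairs `(φ, ∇φ)` with `φ ∈ C_c^∞(Ω)`. -/
def testGraph (Ω : Opens Plane) : Set (GraphSpace Ω) :=
  {p | ∃ φ : 𝓓(Ω, ℝ),
    (p.fst : Plane → ℝ) =ᵐ[volume.restrict (Ω : Set Plane)] (φ : Plane → ℝ) ∧
    (p.snd : Plane → Plane) =ᵐ[volume.restrict (Ω : Set Plane)] ∇ (φ : Plane → ℝ)}

/-- `H₀¹(Ω)`, the closure of `C_c^∞(Ω)` in the `H¹(Ω)` norm. A function `w ∈ H₀¹(Ω)` is represented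
by the pair `(w, ∇w)`, where the weak gradient `∇w` is determined by `w`. (The set `testGraph Ω`
is already a linear subspace; the span only serves to bundle it as such.) -/
def H10 (Ω : Opens Plane) : Submodule ℝ (GraphSpace Ω) :=
  (Submodule.span ℝ (testGraph Ω)).topologicalClosure

/-- The function underlying an element of `H₀¹(Ω)`. -/
def val {Ω : Opens Plane} (w : H10 Ω) : L2 Ω := (w : GraphSpace Ω).fst

/-- The weak gradient of an element of `H₀¹(Ω)`. -/
def wgrad {Ω : Opens Plane} (w : H10 Ω) : L2Vec Ω := (w : GraphSpace Ω).snd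

/-- `d` is the distributional divergence of the vector field `β` on `Ω`. -/
def IsWeakDiv (Ω : Opens Plane) (β : Plane → Plane) (d : Plane → ℝ) : Prop :=
  ∀ φ : 𝓓(Ω, ℝ), ∫ x in (Ω : Set Plane), inner ℝ (β x) (∇ (φ : Plane → ℝ) x)
    = - ∫ x in (Ω : Set Plane), d x * φ x

/-- The matrix field `A` belongs to `L^∞(Ω)^{2×2}`, is symmetric, and satisfies
`ξᵀ A(x) ξ ≥ M |ξ|²` for all `ξ ∈ ℝ²` and almost every `x ∈ Ω`. -/
structure IsEllipticCoeff (Ω : Opens Plane) (M : ℝ) (A : Plane → Matrix (Fin 2) (Fin 2) ℝ) :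
    Prop where
  memLp : ∀ i j, MemLp (fun x => A x i j) ∞ (volume.restrict (Ω : Set Plane))
  symm : ∀ᵐ x ∂(volume.restrict (Ω : Set Plane)), (A x).IsSymm
  posDef : ∀ᵐ x ∂(volume.restrict (Ω : Set Plane)), ∀ ξ : Fin 2 → ℝ,
    M * (ξ ⬝ᵥ ξ) ≤ ξ ⬝ᵥ (A x *ᵥ ξ)

section Forms

variable {Ω : Opens Plane}

/-- `m₁(w, v) = (w, v)`. -/
def m1 (w v : H10 Ω) : ℝ := ∫ x in (Ω : Set Plane), val w x * val v x

/-- `m₂(w, v) = (μ∇w, ∇v)`. -/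
def m2 (μ : Plane → Matrix (Fin 2) (Fin 2) ℝ) (w v : H10 Ω) : ℝ :=
  ∫ x in (Ω : Set Plane), (μ x *ᵥ (wgrad w x).ofLp) ⬝ᵥ (wgrad v x).ofLp

/-- `a(w, v) = (ε∇w, ∇v) + (σw, v)`. -/
def aForm (ε : Plane → Matrix (Fin 2) (Fin 2) ℝ) (σ : Plane → ℝ) (w v : H10 Ω) : ℝ :=
  (∫ x in (Ω : Set Plane), (ε x *ᵥ (wgrad w x).ofLp) ⬝ᵥ (wgrad v x).ofLp)
    + ∫ x in (Ω : Set Plane), σ x * val w x * val v x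

/-- `b(w, v) = ½ [(β·∇w, v) - (w, β·∇v)]`. -/
def bForm (β : Plane → Plane) (w v : H10 Ω) : ℝ :=
  1 / 2 * ((∫ x in (Ω : Set Plane), inner ℝ (β x) (wgrad w x) * val v x)
    - ∫ x in (Ω : Set Plane), val w x * inner ℝ (β x) (wgrad v x))

/-- The pairing `(g, v)` of `g ∈ L²(Ω)` with `v ∈ H₀¹(Ω)`. -/
def source (g : L2 Ω) (v : H10 Ω) : ℝ := ∫ x in (Ω : Set Plane), g x * val v x

end Forms

/-- Lebesgue measure on the time interval `(0, T]`. -/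
abbrev timeMeasure (T : ℝ) : Measure ℝ := volume.restrict (Ioc 0 T)

/-- The open interval `(0, T)`, the domain of the test functions in time. -/
def timeInterior (T : ℝ) : Opens ℝ := ⟨Ioo 0 T, isOpen_Ioo⟩

/-- `u'` is the weak (distributional) time derivative of `u : (0, T) → W`. -/
def IsWeakTimeDeriv {W : Type*} [NormedAddCommGroup W] [NormedSpace ℝ W] (T : ℝ)
    (u u' : ℝ → W) : Prop :=
  ∀ φ : 𝓓(timeInterior T, ℝ),
    ∫ t, deriv (φ : ℝ → ℝ) t • u t ∂(timeMeasure T) = - ∫ t, φ t • u' t ∂(timeMeasure T)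

/-- `u ∈ L²(0, T; H₀¹(Ω))` is a solution of the weak formulation, with `u_t ∈ L^q(0, T; H₀¹(Ω))`.
Since `q ≥ 1` makes `u` equal almost everywhere to a unique continuous function on `[0, T]`,
the initial condition is imposed on that function. -/
def IsWeakSolution (q : ℝ≥0∞) {Ω : Opens Plane} (T : ℝ)
    (μ ε : Plane → Matrix (Fin 2) (Fin 2) ℝ) (β : Plane → Plane) (σ : Plane → ℝ)
    (f : ℝ → L2 Ω) (u₀ : H10 Ω) (u : Lp (H10 Ω) 2 (timeMeasure T)) : Prop :=
  (∃ u' : ℝ → H10 Ω, MemLp u' q (timeMeasure T) ∧ IsWeakTimeDeriv T u u' ∧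
    ∀ᵐ t ∂(timeMeasure T), ∀ v : H10 Ω,
      m1 (u' t) v + m2 μ (u' t) v + aForm ε σ (u t) v + bForm β (u t) v = source (f t) v) ∧
  ∃ uc : ℝ → H10 Ω, ContinuousOn uc (Icc 0 T) ∧ u =ᵐ[timeMeasure T] uc ∧ uc 0 = u₀

end SobolevEq

end

noncomputable section

namespace SobolevEq

/-! The gradient acts on `u_t` as well as on `u`, so the problem is an ordinary differential
equation in the Hilbert space `H10 Ω`. The form `m1 + m2` is coercive for the `H¹` norm and `aForm +
bForm` is bounded, so Lax-Milgram turns the variational identity into `u_t = R f - A u` with bounded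
operators `A` and `R` (`exists_evolution_operators`).

Existence is variation of constants with `exp (t • A)` (`exists_integral_equation_solution`). For
uniqueness, the du Bois-Reymond lemma turns the weak derivative of the difference of two solutions
into an integral equation, and Grönwall's inequality forces the difference to vanish
(`eq_zero_of_integral_equation`). The regularity of `u_t` is read off the equation, since `R f - A
u` is square integrable in time. -/

lemma _root_.ContinuousOn.integrable_timeMeasure {W : Type*} [NormedAddCommGroup W] {T : ℝ}
    {w : ℝ → W} (hw : ContinuousOn w (Icc 0 T)) : Integrable w (timeMeasure T) :=
  (hw.integrableOn_Icc).mono_set Ioc_subset_Icc_self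

/-! ### Weak derivatives in time of Banach-valued functions. -/

section WeakTimeDerivative

variable {W : Type*} [NormedAddCommGroup W] [NormedSpace ℝ W] {T : ℝ}

lemma _root_.TestFunction.eq_zero_of_le_zero (φ : 𝓓(timeInterior T, ℝ)) {t : ℝ} (ht : t ≤ 0) :
    φ t = 0 :=
  image_eq_zero_of_notMem_tsupport fun h => (φ.tsupport_subset h).1.not_ge ht

lemma _root_.TestFunction.eq_zero_of_ge (φ : 𝓓(timeInterior T, ℝ)) {t : ℝ} (ht : T ≤ t) :
    φ t = 0 :=
  image_eq_zero_of_notMem_tsupport fun h => (φ.tsupport_subset h).2.not_ge ht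

lemma _root_.TestFunction.contDiff_infty (φ : 𝓓(timeInterior T, ℝ)) : ContDiff ℝ ∞ φ :=
  φ.contDiff

lemma _root_.TestFunction.differentiable (φ : 𝓓(timeInterior T, ℝ)) : Differentiable ℝ φ :=
  φ.contDiff_infty.differentiable (by simp)

lemma _root_.TestFunction.continuous_deriv (φ : 𝓓(timeInterior T, ℝ)) : Continuous (deriv φ) :=
  φ.contDiff_infty.continuous_deriv (by simp)

lemma _root_.TestFunction.integrable_smul (φ : 𝓓(timeInterior T, ℝ)) {g : ℝ → W}
    (hg : Integrable g (timeMeasure T)) :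
    Integrable (fun t => φ t • g t) (timeMeasure T) := by
  obtain ⟨C, hC⟩ := φ.continuous.bounded_above_of_compact_support φ.hasCompactSupport
  exact hg.bdd_smul C φ.continuous.aestronglyMeasurable (.of_forall hC)

lemma _root_.TestFunction.integrable_deriv_smul (φ : 𝓓(timeInterior T, ℝ)) {g : ℝ → W}
    (hg : Integrable g (timeMeasure T)) :
    Integrable (fun t => deriv φ t • g t) (timeMeasure T) := by
  obtain ⟨C, hC⟩ := φ.continuous_deriv.bounded_above_of_compact_support φ.hasCompactSupport.deriv
  exact hg.bdd_smul C φ.continuous_deriv.aestronglyMeasurable (.of_forall hC)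

lemma IsWeakTimeDeriv.congr {u v u' v' : ℝ → W} (h : IsWeakTimeDeriv T u u')
    (huv : u =ᵐ[timeMeasure T] v) (huv' : u' =ᵐ[timeMeasure T] v') : IsWeakTimeDeriv T v v' := by
  intro φ
  have h1 : ∫ t, deriv (φ : ℝ → ℝ) t • v t ∂(timeMeasure T)
      = ∫ t, deriv (φ : ℝ → ℝ) t • u t ∂(timeMeasure T) :=
    integral_congr_ae (by filter_upwards [huv] with t ht; rw [ht])
  have h2 : ∫ t, φ t • v' t ∂(timeMeasure T) = ∫ t, φ t • u' t ∂(timeMeasure T) :=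
    integral_congr_ae (by filter_upwards [huv'] with t ht; rw [ht])
  rw [h1, h2, h φ]

lemma IsWeakTimeDeriv.sub {u v u' v' : ℝ → W} (hu : IsWeakTimeDeriv T u u')
    (hv : IsWeakTimeDeriv T v v') (iu : Integrable u (timeMeasure T))
    (iv : Integrable v (timeMeasure T)) (iu' : Integrable u' (timeMeasure T))
    (iv' : Integrable v' (timeMeasure T)) :
    IsWeakTimeDeriv T (fun t => u t - v t) (fun t => u' t - v' t) := by
  intro φ
  simp only [smul_sub]
  rw [integral_sub (φ.integrable_deriv_smul iu) (φ.integrable_deriv_smul iv),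
    integral_sub (φ.integrable_smul iu') (φ.integrable_smul iv'), hu φ, hv φ]
  abel

/-- The integral of the derivative of a test function over `(s, T]`. -/
lemma _root_.TestFunction.integral_deriv_Ioc (φ : 𝓓(timeInterior T, ℝ)) {s : ℝ} (hs : s ≤ T) :
    ∫ t in Ioc s T, deriv φ t = - φ s := by
  rw [← intervalIntegral.integral_of_le hs,
    intervalIntegral.integral_deriv_eq_sub (fun x _ => φ.differentiable x)
      (φ.continuous_deriv.intervalIntegrable _ _), φ.eq_zero_of_ge le_rfl, zero_sub]

lemma continuousOn_primitive {g : ℝ → W} (hg : Integrable g (timeMeasure T)) (hT : 0 ≤ T) :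
    ContinuousOn (fun t => ∫ s in (0 : ℝ)..t, g s) (Icc 0 T) := by
  have := intervalIntegral.continuousOn_primitive_interval (μ := volume) (f := g) (a := 0)
    (b := T) (by rw [uIcc_of_le hT]; exact (integrableOn_Icc_iff_integrableOn_Ioc).2 hg)
  rwa [uIcc_of_le hT] at this

/-- A primitive of an integrable function has that function as its weak derivative. -/
theorem isWeakTimeDeriv_primitive [CompleteSpace W] {g : ℝ → W}
    (hg : Integrable g (timeMeasure T)) (hT : 0 ≤ T) (c : W) :
    IsWeakTimeDeriv T (fun t => c + ∫ s in (0 : ℝ)..t, g s) g := by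
  intro φ
  have hG := continuousOn_primitive hg hT
  have hc : ∫ t, deriv φ t • c ∂(timeMeasure T) = 0 := by
    rw [integral_smul_const, φ.integral_deriv_Ioc hT, φ.eq_zero_of_le_zero le_rfl]
    simp
  simp only [smul_add]
  rw [integral_add (φ.integrable_deriv_smul (integrable_const c))
    (φ.integrable_deriv_smul hG.integrable_timeMeasure), hc, zero_add]
  -- Fubini on the triangle `s ≤ t`: integrating `k` in `s` gives `φ'(t) ∫₀ᵗ g`, integrating it in
  -- `t` gives `g(s) ∫ₛᵀ φ' = -φ(s) g(s)`.
  let k : ℝ → ℝ → W := fun t s => (Iic t).indicator (fun s => deriv φ t • g s) s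
  have hk : Integrable (Function.uncurry k) ((timeMeasure T).prod (timeMeasure T)) := by
    have h1 : Integrable (fun p : ℝ × ℝ => deriv φ p.1 • g p.2)
        ((timeMeasure T).prod (timeMeasure T)) :=
      Integrable.smul_prod (f := deriv φ) (g := g)
        φ.continuous_deriv.continuousOn.integrable_timeMeasure hg
    have h2 : Function.uncurry k
        = {p : ℝ × ℝ | p.2 ≤ p.1}.indicator (fun p => deriv φ p.1 • g p.2) := by
      ext ⟨t, s⟩
      simp [k, Function.uncurry, indicator]
    rw [h2]
    exact h1.indicator (measurableSet_le measurable_snd measurable_fst)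
  have hleft : ∀ t ∈ Ioc (0 : ℝ) T,
      deriv φ t • ∫ s in (0 : ℝ)..t, g s = ∫ s, k t s ∂(timeMeasure T) := by
    intro t ht
    simp only [k]
    rw [integral_indicator measurableSet_Iic, Measure.restrict_restrict measurableSet_Iic,
      integral_smul, intervalIntegral.integral_of_le ht.1.le]
    congr 3
    ext s
    simp only [mem_Ioc, mem_inter_iff, mem_Iic]
    exact ⟨fun h => ⟨h.2, h.1, h.2.trans ht.2⟩, fun h => ⟨h.2.1, h.1⟩⟩
  have hright : ∀ s ∈ Ioc (0 : ℝ) T, ∫ t, k t s ∂(timeMeasure T) = - (φ s • g s) := by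
    intro s hs
    have : (fun t => k t s) = (Ici s).indicator (fun t => deriv φ t • g s) := by
      ext t
      simp [k, indicator]
    rw [this, integral_indicator measurableSet_Ici, Measure.restrict_restrict measurableSet_Ici,
      integral_smul_const]
    have hset : Ici s ∩ Ioc 0 T = Icc s T := by
      ext t
      simp only [mem_Icc, mem_inter_iff, mem_Ici, mem_Ioc]
      exact ⟨fun h => ⟨h.1, h.2.2⟩, fun h => ⟨h.1, hs.1.trans_le h.1, h.2⟩⟩
    rw [hset, integral_Icc_eq_integral_Ioc, φ.integral_deriv_Ioc hs.2, neg_smul]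
  rw [setIntegral_congr_fun measurableSet_Ioc hleft, integral_integral_swap hk,
    setIntegral_congr_fun measurableSet_Ioc hright, integral_neg]

/-- A test function of mean zero is the derivative of a test function. -/
lemma exists_testFunction_deriv_eq {θ : ℝ → ℝ} (hθ : ContDiff ℝ ∞ θ) (hs : HasCompactSupport θ)
    (hsub : tsupport θ ⊆ Ioo 0 T) (hT : 0 < T) (hint : ∫ t in (0 : ℝ)..T, θ t = 0) :
    ∃ φ : 𝓓(timeInterior T, ℝ), deriv φ = θ := by
  -- The point `T / 2` keeps `K` nonempty when `θ = 0`, so that its extreme points `a` and `b`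
  -- exist.
  let K : Set ℝ := tsupport θ ∪ {T / 2}
  have hK : IsCompact K := hs.isCompact.union isCompact_singleton
  have hKne : K.Nonempty := ⟨T / 2, Or.inr rfl⟩
  have hKsub : K ⊆ Ioo 0 T :=
    union_subset hsub (singleton_subset_iff.2 ⟨by linarith, by linarith⟩)
  obtain ⟨a, haK, ha⟩ := hK.exists_isLeast hKne
  obtain ⟨b, hbK, hb⟩ := hK.exists_isGreatest hKne
  have hz : ∀ t, t ∉ Icc a b → θ t = 0 := fun t ht =>
    image_eq_zero_of_notMem_tsupport fun h => ht ⟨ha (Or.inl h), hb (Or.inl h)⟩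
  let Θ : ℝ → ℝ := fun t => ∫ s in (0 : ℝ)..t, θ s
  have hd : ∀ t, HasDerivAt Θ (θ t) t := fun t =>
    (hθ.continuous.integral_hasStrictDerivAt 0 t).hasDerivAt
  have hderiv : deriv Θ = θ := funext fun t => (hd t).deriv
  have hsupp : ∀ t, t ∉ Icc a b → Θ t = 0 := by
    intro t ht
    rcases lt_or_ge t a with h | h
    · refine (intervalIntegral.integral_congr (g := fun _ => 0) fun s hs => hz s fun h' => ?_).trans
        (by simp)
      have : s ≤ max 0 t := (mem_uIcc.1 hs).elim (fun h => h.2.trans (le_max_right _ _))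
        (fun h => h.2.trans (le_max_left _ _))
      exact (this.trans_lt (max_lt (hKsub haK).1 h)).not_ge h'.1
    · have hbt : b < t := not_le.1 fun h' => ht ⟨h, h'⟩
      -- To the right of `b` the primitive equals the full integral of `θ`, which vanishes by the
      -- mean-zero assumption.
      have h1 : ∫ s in t..T, θ s = 0 := by
        refine (intervalIntegral.integral_congr (g := fun _ => 0)
          fun s hs => hz s fun h' => ?_).trans (by simp)
        have : min t T ≤ s := (mem_uIcc.1 hs).elim (fun h => (min_le_left _ _).trans h.1)
          (fun h => (min_le_right _ _).trans h.1)
        exact ((lt_min hbt (hKsub hbK).2).trans_le this).not_ge h'.2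
      have h2 := intervalIntegral.integral_add_adjacent_intervals
        (hθ.continuous.intervalIntegrable (μ := volume) 0 t) (hθ.continuous.intervalIntegrable t T)
      rw [h1, hint, add_zero] at h2
      exact h2
  have hts : tsupport Θ ⊆ Icc a b :=
    closure_minimal (fun t ht => by_contra fun h => ht (hsupp t h)) isClosed_Icc
  refine ⟨⟨Θ, ?_, ?_, ?_⟩, hderiv⟩
  · exact contDiff_infty_iff_deriv.2 ⟨fun t => (hd t).differentiableAt, hderiv ▸ hθ⟩
  · exact isCompact_Icc.of_isClosed_subset (isClosed_tsupport _) hts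
  · exact hts.trans (Icc_subset_Ioo (hKsub haK).1 (hKsub hbK).2)

/-- The du Bois-Reymond lemma. -/
theorem eq_of_isWeakTimeDeriv_zero [CompleteSpace W] (hT : 0 < T) {w : ℝ → W}
    (hw : ContinuousOn w (Icc 0 T))
    (h : IsWeakTimeDeriv T w (fun _ => 0)) {t : ℝ} (ht : t ∈ Icc 0 T) : w t = w 0 := by
  let ψ : ContDiffBump (T / 2) := ⟨T / 8, T / 4, by linarith, by linarith⟩
  let ρ : ℝ → ℝ := ψ.normed volume
  have hρs : tsupport ρ ⊆ Ioo 0 T := by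
    rw [ψ.tsupport_normed_eq, Real.closedBall_eq_Icc]
    exact Icc_subset_Ioo (by change 0 < T / 2 - T / 4; linarith)
      (by change T / 2 + T / 4 < T; linarith)
  have hρc : HasCompactSupport ρ := ψ.hasCompactSupport_normed
  have hρd : ContDiff ℝ ∞ ρ := ψ.contDiff_normed
  have hsupp : ∀ g : ℝ → ℝ, tsupport g ⊆ Ioo 0 T → ∫ t in (0 : ℝ)..T, g t = ∫ t, g t := by
    intro g hg
    rw [intervalIntegral.integral_of_le hT.le]
    exact setIntegral_eq_integral_of_forall_compl_eq_zero fun x hx =>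
      image_eq_zero_of_notMem_tsupport fun h => hx (Ioo_subset_Ioc_self (hg h))
  have hρ1 : ∫ t in (0 : ℝ)..T, ρ t = 1 := (hsupp ρ hρs).trans ψ.integral_normed
  have hwi : Integrable w (timeMeasure T) := hw.integrable_timeMeasure
  -- If `w` is constant, its value is its average against `ρ`, which has integral one.
  set c : W := ∫ t, ρ t • w t ∂(timeMeasure T) with hc
  have key : ∀ g : ℝ → ℝ, ContDiff ℝ ∞ g → HasCompactSupport g → tsupport g ⊆ Ioo 0 T →
      ∫ x, g x • (w x - c) ∂(timeMeasure T) = 0 := by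
    intro g hg hgc hgs
    have hbd : ∀ k : ℝ → ℝ, Continuous k → HasCompactSupport k →
        Integrable (fun t => k t • w t) (timeMeasure T) := by
      intro k hk hkc
      obtain ⟨C, hC⟩ := hk.bounded_above_of_compact_support hkc
      exact hwi.bdd_smul C hk.aestronglyMeasurable (.of_forall hC)
    set m : ℝ := ∫ t in (0 : ℝ)..T, g t with hm
    rw [intervalIntegral.integral_of_le hT.le] at hm
    have hθs : tsupport (fun t => g t - m * ρ t) ⊆ tsupport g ∪ tsupport ρ := by
      refine closure_minimal (fun t ht => ?_) ((isClosed_tsupport g).union (isClosed_tsupport ρ))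
      by_contra hn
      rw [mem_union, not_or] at hn
      exact ht (by simp [image_eq_zero_of_notMem_tsupport hn.1,
        image_eq_zero_of_notMem_tsupport hn.2])
    -- Subtracting `m * ρ` from `g` removes its mean, so the difference is an admissible `φ'`;
    -- testing with `φ` gives `∫ g w = m c`.
    obtain ⟨φ, hφ⟩ := exists_testFunction_deriv_eq (θ := fun t => g t - m * ρ t) (T := T)
      (hg.sub (contDiff_const.mul hρd))
      ((hgc.isCompact.union hρc.isCompact).of_isClosed_subset (isClosed_tsupport _) hθs)
      (hθs.trans (union_subset hgs hρs)) hT (by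
        rw [intervalIntegral.integral_sub (hg.continuous.intervalIntegrable _ _)
          ((hρd.continuous.const_mul m).intervalIntegrable _ _),
          intervalIntegral.integral_const_mul, hρ1, mul_one, sub_self])
    have h1 := h φ
    rw [hφ] at h1
    simp only [smul_zero, integral_zero, neg_zero, sub_smul, mul_smul] at h1
    rw [integral_sub (hbd g hg.continuous hgc)
      (g := fun t => m • ρ t • w t) ((hbd ρ hρd.continuous hρc).smul m), integral_smul, ← hc] at h1
    simp only [smul_sub]
    rw [integral_sub (hbd g hg.continuous hgc)
      (hg.continuous.continuousOn.integrable_timeMeasure.smul_const c), integral_smul_const,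
      ← hm]
    exact h1
  have hae : ∀ᵐ x ∂(timeMeasure T), x ∈ Ioo 0 T → w x - c = 0 :=
    isOpen_Ioo.ae_eq_zero_of_integral_contDiff_smul_eq_zero
      ((hwi.sub (integrable_const c)).locallyIntegrable.locallyIntegrableOn _) key
  have hae' : w =ᵐ[volume.restrict (Icc 0 T)] fun _ => c := by
    rw [← restrict_Ioo_eq_restrict_Icc, Filter.EventuallyEq, ae_restrict_iff' measurableSet_Ioo]
    have := (ae_restrict_iff' measurableSet_Ioc).1 hae
    filter_upwards [this] with x hx hx'
    exact sub_eq_zero.1 (hx (Ioo_subset_Ioc_self hx') hx')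
  -- Continuity upgrades equality almost everywhere to equality on all of `[0, T]`, endpoints
  -- included.
  have heq := Measure.eqOn_Icc_of_ae_eq volume hT.ne hae' hw continuousOn_const
  rw [heq ht, heq (left_mem_Icc.2 hT.le)]

/-- The fundamental theorem of calculus for weak derivatives. -/
theorem IsWeakTimeDeriv.eq_add_integral [CompleteSpace W] (hT : 0 < T) {w w' : ℝ → W}
    (hw : ContinuousOn w (Icc 0 T)) (hw' : Integrable w' (timeMeasure T))
    (h : IsWeakTimeDeriv T w w') {t : ℝ} (ht : t ∈ Icc 0 T) :
    w t = w 0 + ∫ s in (0 : ℝ)..t, w' s := by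
  have hG : ContinuousOn (fun t => w 0 + ∫ s in (0 : ℝ)..t, w' s) (Icc 0 T) :=
    continuousOn_const.add (continuousOn_primitive hw' hT.le)
  have h0 := h.sub (isWeakTimeDeriv_primitive hw' hT.le (w 0)) hw.integrable_timeMeasure
    hG.integrable_timeMeasure hw' hw'
  simp only [sub_self] at h0
  have := eq_of_isWeakTimeDeriv_zero hT (hw.sub hG) h0 ht
  rw [Pi.sub_apply, Pi.sub_apply, intervalIntegral.integral_same, add_zero, sub_self] at this
  exact sub_eq_zero.1 this

end WeakTimeDerivative

/-! ### Linear differential equations with a bounded operator. -/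

section LinearODE

variable {W : Type*} [NormedAddCommGroup W] [NormedSpace ℝ W] [CompleteSpace W] {T : ℝ}

/-- Variation of constants: the integral equation `u(t) = u₀ + ∫₀ᵗ (F - A u)` has a continuous
solution. -/
theorem exists_integral_equation_solution (A : W →L[ℝ] W) {F : ℝ → W}
    (hF : Integrable F (timeMeasure T)) (u₀ : W) :
    ∃ u : ℝ → W, Continuous u ∧
      ∀ t ∈ Icc 0 T, u t = u₀ + ∫ s in (0 : ℝ)..t, (F s - A (u s)) := by
  -- Extension by zero makes the primitive `G` of `F` continuous on the whole line.
  have hF' : Integrable ((Ioc 0 T).indicator F) volume :=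
    (integrable_indicator_iff measurableSet_Ioc).2 hF
  let G : ℝ → W := fun t => ∫ s in (0 : ℝ)..t, (Ioc 0 T).indicator F s
  have hG : Continuous G := intervalIntegral.continuous_primitive
    (fun a b => hF'.intervalIntegrable) 0
  let E : ℝ → W →L[ℝ] W := fun t => NormedSpace.exp (t • A)
  have hE : ∀ t, HasDerivAt E (A * E t) t := fun t => hasDerivAt_exp_smul_const' A t
  have hEc : Continuous E := continuous_iff_continuousAt.2 fun t => (hE t).continuousAt
  have hE0 : E 0 = 1 := by simp [E]
  have hEE : ∀ t, E (-t) * E t = 1 := by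
    intro t
    let := NormedAlgebra.restrictScalars ℚ ℝ (W →L[ℝ] W)
    simp only [E]
    rw [← NormedSpace.exp_add_of_commute (((Commute.refl A).smul_left _).smul_right _),
      neg_smul, neg_add_cancel, NormedSpace.exp_zero]
  -- As `F` is merely integrable, `u` need not be differentiable. But `v = u - G` should solve `v' =
  -- -A (v + G)`, whose forcing is continuous; `E (-t) (p t)` is its Duhamel formula.
  let p : ℝ → W := fun t => u₀ - ∫ s in (0 : ℝ)..t, E s (A (G s))
  have hpc : Continuous fun s => E s (A (G s)) := hEc.clm_apply (A.continuous.comp hG)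
  have hp : ∀ t, HasDerivAt p (- E t (A (G t))) t := fun t =>
    (hpc.integral_hasStrictDerivAt 0 t).hasDerivAt.const_sub u₀
  let v : ℝ → W := fun t => E (-t) (p t)
  have hv : ∀ t, HasDerivAt v (- A (v t + G t)) t := by
    intro t
    have h1 : HasDerivAt (fun t => E (-t)) (-(A * E (-t))) t := by
      simpa [Function.comp_def] using (hE (-t)).scomp t (hasDerivAt_neg t)
    refine (h1.clm_apply (hp t)).congr_deriv ?_
    have h2 : E (-t) (E t (A (G t))) = A (G t) := by
      rw [← mul_apply_eq_comp, hEE, one_apply_eq_self]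
    simp only [v, map_neg, h2, map_add, _root_.neg_apply,
      mul_apply_eq_comp]
    exact (neg_add _ _).symm
  have hvc : Continuous v := continuous_iff_continuousAt.2 fun t => (hv t).continuousAt
  refine ⟨fun t => v t + G t, hvc.add hG, fun t ht => ?_⟩
  have hAc : Continuous fun s => A (v s + G s) := A.continuous.comp (hvc.add hG)
  have h1 : ∫ s in (0 : ℝ)..t, - A (v s + G s) = v t - v 0 :=
    intervalIntegral.integral_eq_sub_of_hasDerivAt (fun s _ => hv s)
      (hAc.neg.intervalIntegrable _ _)
  have hv0 : v 0 = u₀ := by simp [v, p, hE0]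
  have hFt : IntervalIntegrable F volume 0 t :=
    (intervalIntegrable_iff_integrableOn_Ioc_of_le ht.1).2
      (hF.mono_measure (Measure.restrict_mono (Ioc_subset_Ioc_right ht.2) le_rfl))
  have hGt : G t = ∫ s in (0 : ℝ)..t, F s := by
    refine intervalIntegral.integral_congr_ae (.of_forall fun s hs => ?_)
    rw [uIoc_of_le ht.1] at hs
    exact indicator_of_mem (Ioc_subset_Ioc_right ht.2 hs) F
  rw [intervalIntegral.integral_neg, hv0] at h1
  rw [intervalIntegral.integral_sub hFt (hAc.intervalIntegrable _ _), ← hGt, sub_eq_add_neg, h1]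
  rw [add_left_comm, add_sub_cancel, add_comm]

/-- A continuous solution of the homogeneous integral equation vanishes. -/
theorem eq_zero_of_integral_equation (A : W →L[ℝ] W) {w : ℝ → W} (hT : 0 ≤ T)
    (hw : ContinuousOn w (Icc 0 T)) (h : ∀ t ∈ Icc 0 T, w t = - ∫ s in (0 : ℝ)..t, A (w s)) :
    ∀ t ∈ Icc 0 T, w t = 0 := by
  -- The constant extension past the endpoints makes the primitive `y` differentiable at every real
  -- point.
  let z : ℝ → W := IccExtend hT ((Icc 0 T).domRestrict w)
  have hz : Continuous z := (continuousOn_iff_continuous_domRestrict.1 hw).Icc_extend'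
  have hzw : ∀ t ∈ Icc 0 T, z t = w t := fun t ht => IccExtend_of_mem hT _ ht
  let y : ℝ → W := fun t => - ∫ s in (0 : ℝ)..t, A (z s)
  have hy : ∀ t, HasDerivAt y (- A (z t)) t := fun t =>
    ((A.continuous.comp hz).integral_hasStrictDerivAt 0 t).hasDerivAt.neg
  have hyw : ∀ t ∈ Icc 0 T, y t = w t := by
    intro t ht
    rw [h t ht]
    refine congrArg Neg.neg (intervalIntegral.integral_congr fun s hs => ?_)
    rw [uIcc_of_le ht.1] at hs
    exact congrArg A (hzw s (Icc_subset_Icc_right ht.2 hs))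
  intro t ht
  rw [← hyw t ht]
  -- Grönwall: `y 0 = 0` and `‖y'‖ ≤ ‖A‖ ‖y‖`.
  refine eq_zero_of_abs_deriv_le_mul_abs_self_of_eq_zero_right (K := ‖A‖)
    (fun s _ => (hy s).continuousAt.continuousWithinAt) (fun s _ => (hy s).hasDerivWithinAt)
    (by simp [y]) (fun s hs => ?_) t ht
  have hs' := Ico_subset_Icc_self hs
  rw [norm_neg, hyw s hs', hzw s hs']
  exact A.le_opNorm _

end LinearODE

/-! ### Bounded forms on `H₀¹(Ω)` and reduction to an operator equation. -/

section BoundedForms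

variable {Ω : Opens Plane}

instance (Ω : Opens Plane) : CompleteSpace (H10 Ω) :=
  (Submodule.isClosed_topologicalClosure _).completeSpace_coe

/-- The inclusion `H₀¹(Ω) → L²(Ω)`. -/
def valL (Ω : Opens Plane) : H10 Ω →L[ℝ] L2 Ω :=
  WithLp.fstL 2 ℝ (L2 Ω) (L2Vec Ω) ∘L (H10 Ω).subtypeL

/-- The weak gradient `H₀¹(Ω) → L²(Ω)²`. -/
def gradL (Ω : Opens Plane) : H10 Ω →L[ℝ] L2Vec Ω :=
  WithLp.sndL 2 ℝ (L2 Ω) (L2Vec Ω) ∘L (H10 Ω).subtypeL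

@[simp] lemma valL_apply (w : H10 Ω) : valL Ω w = val w := rfl

@[simp] lemma gradL_apply (w : H10 Ω) : gradL Ω w = wgrad w := rfl

lemma norm_sq_eq (w : H10 Ω) : ‖w‖ ^ 2 = ‖val w‖ ^ 2 + ‖wgrad w‖ ^ 2 :=
  WithLp.prod_norm_sq_eq_of_L2 (w : GraphSpace Ω)

lemma real_inner_mul (a b : ℝ) : inner ℝ a b = a * b := mul_comm b a

/-- Multiplication of square integrable functions by an essentially bounded operator field. -/
lemma exists_mulOperator {α E F : Type*} {m : MeasurableSpace α} {ν : Measure α}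
    [NormedAddCommGroup E] [NormedSpace ℝ E] [NormedAddCommGroup F] [NormedSpace ℝ F]
    {K : α → E →L[ℝ] F} (hK : MemLp K ∞ ν) :
    ∃ P : Lp E 2 ν →L[ℝ] Lp F 2 ν, ∀ g, P g =ᵐ[ν] fun x => K x (g x) := by
  -- Hölder's inequality with exponents `∞`, `2`, `2`, for the evaluation pairing of operators with
  -- vectors.
  refine ⟨(ContinuousLinearMap.id ℝ (E →L[ℝ] F)).holderL ν ∞ 2 2 hK.toLp, fun g => ?_⟩
  rw [ContinuousLinearMap.holderL_apply_apply]
  filter_upwards [ContinuousLinearMap.coeFn_holder (r := 2)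
    (ContinuousLinearMap.id ℝ (E →L[ℝ] F)) hK.toLp g, hK.coeFn_toLp] with x h1 h2
  rw [h1, h2]
  rfl

/-- The bilinear form `(P w, Q v)`. -/
def innerForm {H E : Type*} [NormedAddCommGroup H] [NormedSpace ℝ H] [NormedAddCommGroup E]
    [InnerProductSpace ℝ E] (P Q : H →L[ℝ] E) : H →L[ℝ] H →L[ℝ] ℝ :=
  (innerSL ℝ : E →L[ℝ] E →L[ℝ] ℝ).bilinearComp P Q

lemma innerForm_apply {H E : Type*} [NormedAddCommGroup H] [NormedSpace ℝ H]
    [NormedAddCommGroup E] [InnerProductSpace ℝ E] (P Q : H →L[ℝ] E) (w v : H) :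
    innerForm P Q w v = inner ℝ (P w) (Q v) := rfl

/-- Linear images of a matrix field with entries in `L^p` are in `L^p`. -/
lemma memLp_linearMap_matrix {α m n G : Type*} [Fintype m] [Fintype n] [DecidableEq m]
    [DecidableEq n] {mα : MeasurableSpace α} {ν : Measure α} {p : ℝ≥0∞} [NormedAddCommGroup G]
    [NormedSpace ℝ G] (L : Matrix m n ℝ →ₗ[ℝ] G) {A : α → Matrix m n ℝ}
    (hA : ∀ i j, MemLp (fun x => A x i j) p ν) : MemLp (fun x => L (A x)) p ν := by
  have h : (fun x => L (A x)) = fun x => ∑ i, ∑ j, A x i j • L (Matrix.single i j 1) := by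
    ext1 x
    conv_lhs => rw [Matrix.matrix_eq_sum_single (A x)]
    simp only [map_sum, ← map_smul, Matrix.smul_single, smul_eq_mul, mul_one]
  rw [h]
  exact memLp_finsetSum _ fun i _ => memLp_finsetSum _ fun j _ =>
    ((ContinuousLinearMap.id ℝ ℝ).smulRight (L (Matrix.single i j 1))).comp_memLp' (hA i j)

lemma IsEllipticCoeff.memLp_toEuclideanCLM {M : ℝ} {A : Plane → Matrix (Fin 2) (Fin 2) ℝ}
    (hA : IsEllipticCoeff Ω M A) :
    MemLp (fun x => Matrix.toEuclideanCLM (n := Fin 2) (𝕜 := ℝ) (A x)) ∞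
      (volume.restrict (Ω : Set Plane)) :=
  memLp_linearMap_matrix
    (Matrix.toEuclideanCLM (n := Fin 2) (𝕜 := ℝ)).toAlgEquiv.toLinearMap hA.memLp

/-- Multiplication by the matrix field is a bounded operator `P` on `L²(Ω)²`, so `(P ∇w, ∇v)` is a
bounded form; the lower bound is the pointwise ellipticity, integrated. -/
lemma IsEllipticCoeff.exists_form {M : ℝ} {A : Plane → Matrix (Fin 2) (Fin 2) ℝ}
    (hA : IsEllipticCoeff Ω M A) :
    ∃ B : H10 Ω →L[ℝ] H10 Ω →L[ℝ] ℝ, (∀ w v, B w v = m2 A w v) ∧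
      ∀ w, M * ‖wgrad w‖ ^ 2 ≤ B w w := by
  obtain ⟨P, hP⟩ := exists_mulOperator hA.memLp_toEuclideanCLM
  refine ⟨innerForm (P ∘L gradL Ω) (gradL Ω), fun w v => ?_, fun w => ?_⟩
  · rw [innerForm_apply, L2.inner_def]
    refine integral_congr_ae ?_
    filter_upwards [hP (wgrad w)] with x hx
    simp only [ContinuousLinearMap.comp_apply, gradL_apply, hx,
      EuclideanSpace.inner_eq_star_dotProduct, star_trivial, Matrix.ofLp_toEuclideanCLM]
    exact dotProduct_comm _ _
  · rw [innerForm_apply, ← real_inner_self_eq_norm_sq, L2.inner_def, L2.inner_def,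
      ← integral_const_mul]
    refine integral_mono_ae ((L2.integrable_inner _ _).const_mul M) (L2.integrable_inner _ _) ?_
    filter_upwards [hP (wgrad w), hA.posDef] with x hx hpos
    simp only [ContinuousLinearMap.comp_apply, gradL_apply, hx,
      EuclideanSpace.inner_eq_star_dotProduct, star_trivial, Matrix.ofLp_toEuclideanCLM]
    exact hpos _

lemma exists_reactionForm {σ : Plane → ℝ} (hσ : MemLp σ ∞ (volume.restrict (Ω : Set Plane))) :
    ∃ B : H10 Ω →L[ℝ] H10 Ω →L[ℝ] ℝ,
      ∀ w v, B w v = ∫ x in (Ω : Set Plane), σ x * val w x * val v x := by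
  obtain ⟨P, hP⟩ := exists_mulOperator ((ContinuousLinearMap.mul ℝ ℝ).comp_memLp' hσ)
  refine ⟨innerForm (P ∘L valL Ω) (valL Ω), fun w v => ?_⟩
  rw [innerForm_apply, L2.inner_def]
  refine integral_congr_ae ?_
  filter_upwards [hP (val w)] with x hx
  simp only [ContinuousLinearMap.comp_apply, valL_apply, hx, real_inner_mul, Function.comp_apply,
    ContinuousLinearMap.mul_apply']

lemma exists_convectionForm {β : Plane → Plane}
    (hβ : MemLp β ∞ (volume.restrict (Ω : Set Plane))) :
    ∃ B : H10 Ω →L[ℝ] H10 Ω →L[ℝ] ℝ, ∀ w v, B w v = bForm β w v := by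
  obtain ⟨P, hP⟩ := exists_mulOperator ((innerSL ℝ : Plane →L[ℝ] Plane →L[ℝ] ℝ).comp_memLp' hβ)
  refine ⟨(1 / 2 : ℝ) • (innerForm (P ∘L gradL Ω) (valL Ω) - innerForm (valL Ω) (P ∘L gradL Ω)),
    fun w v => ?_⟩
  simp only [_root_.smul_apply, _root_.sub_apply, innerForm_apply, L2.inner_def, smul_eq_mul, bForm]
  congr 2
  · refine integral_congr_ae ?_
    filter_upwards [hP (wgrad w)] with x hx
    simp only [ContinuousLinearMap.comp_apply, valL_apply, gradL_apply, hx, real_inner_mul,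
      Function.comp_apply, innerSL_apply_apply]
  · refine integral_congr_ae ?_
    filter_upwards [hP (wgrad v)] with x hx
    simp only [ContinuousLinearMap.comp_apply, valL_apply, gradL_apply, hx, real_inner_mul,
      Function.comp_apply, innerSL_apply_apply]

lemma exists_aForm {M : ℝ} {ε : Plane → Matrix (Fin 2) (Fin 2) ℝ} (hε : IsEllipticCoeff Ω M ε)
    {σ : Plane → ℝ} (hσ : MemLp σ ∞ (volume.restrict (Ω : Set Plane))) :
    ∃ B : H10 Ω →L[ℝ] H10 Ω →L[ℝ] ℝ, ∀ w v, B w v = aForm ε σ w v := by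
  obtain ⟨B₁, h₁, -⟩ := hε.exists_form
  obtain ⟨B₂, h₂⟩ := exists_reactionForm hσ
  refine ⟨B₁ + B₂, fun w v => ?_⟩
  rw [_root_.add_apply, _root_.add_apply, h₁, h₂]
  rfl

lemma source_eq_inner (g : L2 Ω) (v : H10 Ω) : source g v = inner ℝ g (val v) := by
  simp only [source, L2.inner_def, real_inner_mul]

lemma IsEllipticCoeff.exists_coercive_massForm {M : ℝ} (hM : 0 < M)
    {μ : Plane → Matrix (Fin 2) (Fin 2) ℝ} (hμ : IsEllipticCoeff Ω M μ) :
    ∃ B : H10 Ω →L[ℝ] H10 Ω →L[ℝ] ℝ, (∀ w v, B w v = m1 w v + m2 μ w v) ∧ IsCoercive B := by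
  obtain ⟨B, hB, hBc⟩ := hμ.exists_form
  -- The form dominates `‖w‖² + M ‖∇w‖²`, hence `min 1 M` times the squared `H¹` norm.
  refine ⟨innerForm (valL Ω) (valL Ω) + B, fun w v => ?_, min 1 M, lt_min one_pos hM, fun w => ?_⟩
  · rw [_root_.add_apply, _root_.add_apply, hB, innerForm_apply]
    exact congrArg (· + _) (source_eq_inner (val w) v).symm
  · rw [_root_.add_apply, _root_.add_apply, innerForm_apply, valL_apply,
      real_inner_self_eq_norm_sq, mul_assoc, ← sq, norm_sq_eq, mul_add]
    exact add_le_add (mul_le_of_le_one_left (sq_nonneg _) (min_le_left _ _))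
      ((mul_le_mul_of_nonneg_right (min_le_right _ _) (sq_nonneg _)).trans (hBc w))

/-- A linear evolution equation `B(y, ·) + C(x, ·) = (g, J ·)` with coercive `B` is solved for `y`
by the Lax-Milgram theorem. -/
theorem _root_.IsCoercive.exists_solution_operators {H E : Type*} [NormedAddCommGroup H]
    [InnerProductSpace ℝ H] [CompleteSpace H] [NormedAddCommGroup E] [InnerProductSpace ℝ E]
    [CompleteSpace E] {B : H →L[ℝ] H →L[ℝ] ℝ} (hB : IsCoercive B) (C : H →L[ℝ] H →L[ℝ] ℝ)
    (J : H →L[ℝ] E) :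
    ∃ (A : H →L[ℝ] H) (R : E →L[ℝ] H), ∀ (y x : H) (g : E),
      (∀ v, B y v + C x v = inner ℝ g (J v)) ↔ y = R g - A x := by
  -- With `e` and `D` the Riesz representatives of `B` and `C`, the equation reads `e y + D x = J*
  -- g`, and Lax-Milgram makes `e` invertible.
  let e := hB.continuousLinearEquivOfBilin
  let D : H →L[ℝ] H := InnerProductSpace.continuousLinearMapOfBilin (𝕜 := ℝ) C
  have hD : ∀ x v, inner ℝ (D x) v = C x v :=
    InnerProductSpace.continuousLinearMapOfBilin_apply C
  refine ⟨(e.symm : H →L[ℝ] H) ∘L D, (e.symm : H →L[ℝ] H) ∘L J.adjoint, fun y x g => ?_⟩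
  have h1 : (y = e.symm (J.adjoint g) - e.symm (D x)) ↔ e y + D x = J.adjoint g := by
    rw [← map_sub, ← eq_sub_iff_add_eq]
    exact e.toEquiv.eq_symm_apply
  refine Iff.trans ?_ h1.symm
  refine Iff.trans (forall_congr' fun v => ?_)
    ⟨fun h => ext_inner_right ℝ h, fun h v => congrArg (inner ℝ · v) h⟩
  rw [inner_add_left, hB.continuousLinearEquivOfBilin_apply, hD,
    ContinuousLinearMap.adjoint_inner_left]

/-- The variational equation is a linear differential equation with bounded coefficients
in `H₀¹(Ω)`. -/
theorem exists_evolution_operators {μ ε : Plane → Matrix (Fin 2) (Fin 2) ℝ} {M : ℝ} (hM : 0 < M)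
    (hμ : IsEllipticCoeff Ω M μ) (hε : IsEllipticCoeff Ω M ε) {β : Plane → Plane}
    (hβ : MemLp β ∞ (volume.restrict (Ω : Set Plane)))
    {σ : Plane → ℝ} (hσ : MemLp σ ∞ (volume.restrict (Ω : Set Plane))) :
    ∃ (A : H10 Ω →L[ℝ] H10 Ω) (R : L2 Ω →L[ℝ] H10 Ω), ∀ (y x : H10 Ω) (g : L2 Ω),
      (∀ v, m1 y v + m2 μ y v + aForm ε σ x v + bForm β x v = source g v) ↔ y = R g - A x := by
  obtain ⟨B, hB, hBc⟩ := hμ.exists_coercive_massForm hM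
  obtain ⟨C₁, hC₁⟩ := exists_aForm hε hσ
  obtain ⟨C₂, hC₂⟩ := exists_convectionForm hβ
  obtain ⟨A, R, h⟩ := hBc.exists_solution_operators (C₁ + C₂) (valL Ω)
  refine ⟨A, R, fun y x g => Iff.trans (forall_congr' fun v => ?_) (h y x g)⟩
  rw [hB, _root_.add_apply, _root_.add_apply, hC₁, hC₂, valL_apply, source_eq_inner, add_assoc]

end BoundedForms

/-! ### Existence, uniqueness and regularity of weak solutions. -/

section Existence

variable {Ω : Opens Plane} {T : ℝ} {μ ε : Plane → Matrix (Fin 2) (Fin 2) ℝ} {β : Plane → Plane}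
  {σ : Plane → ℝ} {f : ℝ → L2 Ω} {u₀ : H10 Ω} {A : H10 Ω →L[ℝ] H10 Ω} {R : L2 Ω →L[ℝ] H10 Ω}

/-- The equation `u_t = R f - A u` has a solution. -/
theorem exists_isWeakSolution (hT : 0 < T)
    (hAR : ∀ (y x : H10 Ω) (g : L2 Ω),
      (∀ v, m1 y v + m2 μ y v + aForm ε σ x v + bForm β x v = source g v) ↔ y = R g - A x)
    (hf : MemLp f 2 (timeMeasure T)) :
    ∃ u : Lp (H10 Ω) 2 (timeMeasure T), IsWeakSolution 2 T μ ε β σ f u₀ u := by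
  have hRf : MemLp (fun t => R (f t)) 2 (timeMeasure T) := R.comp_memLp' hf
  obtain ⟨u, huc, hu⟩ := exists_integral_equation_solution A (hRf.integrable one_le_two) u₀
  obtain ⟨C, hC⟩ := isCompact_Icc.exists_bound_of_continuousOn (s := Icc 0 T) huc.continuousOn
  have hu2 : MemLp u 2 (timeMeasure T) := MemLp.of_bound huc.continuousOn.integrable_timeMeasure.aestronglyMeasurable C <|
    (ae_restrict_iff' measurableSet_Ioc).2 (.of_forall fun t ht => hC t (Ioc_subset_Icc_self ht))
  have hu' : MemLp (fun t => R (f t) - A (u t)) 2 (timeMeasure T) := hRf.sub (A.comp_memLp' hu2)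
  refine ⟨hu2.toLp, ⟨fun t => R (f t) - A (u t), hu', ?_, ?_⟩,
    u, huc.continuousOn, hu2.coeFn_toLp, ?_⟩
  · refine (isWeakTimeDeriv_primitive (hu'.integrable one_le_two) hT.le u₀).congr ?_ .rfl
    refine Filter.EventuallyEq.trans ?_ hu2.coeFn_toLp.symm
    exact (ae_restrict_iff' measurableSet_Ioc).2
      (.of_forall fun t ht => (hu t (Ioc_subset_Icc_self ht)).symm)
  · filter_upwards [hu2.coeFn_toLp] with t ht
    rw [hAR, ht]
  · simpa using hu 0 (left_mem_Icc.2 hT.le)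

/-- Weak solutions of `u_t = R f - A u` are unique. -/
theorem IsWeakSolution.unique (hT : 0 < T)
    (hAR : ∀ (y x : H10 Ω) (g : L2 Ω),
      (∀ v, m1 y v + m2 μ y v + aForm ε σ x v + bForm β x v = source g v) ↔ y = R g - A x)
    {u v : Lp (H10 Ω) 2 (timeMeasure T)} (hu : IsWeakSolution 1 T μ ε β σ f u₀ u)
    (hv : IsWeakSolution 1 T μ ε β σ f u₀ v) : u = v := by
  obtain ⟨⟨u', hu', hud, hue⟩, uc, huc, huuc, hu0⟩ := hu
  obtain ⟨⟨v', hv', hvd, hve⟩, vc, hvc, hvvc, hv0⟩ := hv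
  have hwd : IsWeakTimeDeriv T (fun t => uc t - vc t) (fun t => u' t - v' t) :=
    (hud.congr huuc .rfl).sub (hvd.congr hvvc .rfl) huc.integrable_timeMeasure
      hvc.integrable_timeMeasure (memLp_one_iff_integrable.1 hu') (memLp_one_iff_integrable.1 hv')
  -- The source cancels in the difference, leaving the homogeneous equation.
  have hwe : (fun t => u' t - v' t) =ᵐ[timeMeasure T] fun t => - A (uc t - vc t) := by
    filter_upwards [hue, hve, huuc, hvvc] with t h1 h2 h3 h4
    rw [(hAR _ _ _).1 h1, (hAR _ _ _).1 h2, h3, h4, map_sub]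
    abel
  have hwc : ContinuousOn (fun t => uc t - vc t) (Icc 0 T) := huc.sub hvc
  have hAw : Integrable (fun t => - A (uc t - vc t)) (timeMeasure T) :=
    (A.continuous.comp_continuousOn hwc).neg.integrable_timeMeasure
  have hzero := eq_zero_of_integral_equation A hT.le hwc fun t ht => by
    rw [(hwd.congr .rfl hwe).eq_add_integral hT hwc hAw ht, hu0, hv0, sub_self, zero_add,
      intervalIntegral.integral_neg]
  refine Lp.ext ?_
  have hae : ∀ᵐ t ∂(timeMeasure T), t ∈ Ioc 0 T := ae_restrict_mem measurableSet_Ioc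
  filter_upwards [huuc, hvvc, hae] with t h1 h2 h3
  rw [h1, h2]
  exact sub_eq_zero.1 (hzero t (Ioc_subset_Icc_self h3))

/-- The time derivative of a weak solution of `u_t = R f - A u` is square integrable. -/
theorem IsWeakSolution.sq_integrable_deriv
    (hAR : ∀ (y x : H10 Ω) (g : L2 Ω),
      (∀ v, m1 y v + m2 μ y v + aForm ε σ x v + bForm β x v = source g v) ↔ y = R g - A x)
    (hf : MemLp f 2 (timeMeasure T)) {q : ℝ≥0∞} {u : Lp (H10 Ω) 2 (timeMeasure T)}
    (hu : IsWeakSolution q T μ ε β σ f u₀ u) : IsWeakSolution 2 T μ ε β σ f u₀ u := by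
  obtain ⟨⟨u', -, hud, hue⟩, hcont⟩ := hu
  refine ⟨⟨u', ?_, hud, hue⟩, hcont⟩
  -- The equation identifies `u'` with this function almost everywhere, whatever `q` is.
  have h : MemLp (fun t => R (f t) - A (u t)) 2 (timeMeasure T) :=
    (R.comp_memLp' hf).sub (A.comp_memLp' (Lp.memLp u))
  refine h.ae_eq ?_
  filter_upwards [hue] with t ht
  exact ((hAR _ _ _).1 ht).symm

/-- The time interval has finite measure. This places the solution constructed with `q = 2` in the
larger class `q = 1`, where uniqueness is proved. -/
lemma IsWeakSolution.mono {p q : ℝ≥0∞} (hpq : p ≤ q) {u : Lp (H10 Ω) 2 (timeMeasure T)}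
    (hu : IsWeakSolution q T μ ε β σ f u₀ u) : IsWeakSolution p T μ ε β σ f u₀ u := by
  obtain ⟨⟨u', hu', h⟩, hcont⟩ := hu
  exact ⟨⟨u', hu'.mono_exponent hpq, h⟩, hcont⟩

end Existence

end SobolevEq

end

theorem theorem2p2 (Ω : Opens SobolevEq.Plane) (T : ℝ) (hT : 0 < T)
    -- dispersion and diffusion coefficients
    (μ ε : SobolevEq.Plane → Matrix (Fin 2) (Fin 2) ℝ) (M : ℝ) (hM : 0 < M)
    (hμ : SobolevEq.IsEllipticCoeff Ω M μ) (hε : SobolevEq.IsEllipticCoeff Ω M ε)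
    -- reaction and convection coefficients, and the divergence of the latter
    (γ : SobolevEq.Plane → ℝ) (hγ : MemLp γ ∞ (volume.restrict (Ω : Set SobolevEq.Plane)))
    (β : SobolevEq.Plane → SobolevEq.Plane)
    (hβ : MemLp β ∞ (volume.restrict (Ω : Set SobolevEq.Plane)))
    (divβ : SobolevEq.Plane → ℝ)
    (hdivβ : MemLp divβ ∞ (volume.restrict (Ω : Set SobolevEq.Plane)))
    (hdiv : SobolevEq.IsWeakDiv Ω β divβ)
    (σ : SobolevEq.Plane → ℝ) (hσ : ∀ x, σ x = γ x - 1 / 2 * divβ x)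
    (σ₀ : ℝ) (hσ₀ : 0 ≤ σ₀)
    (hσσ₀ : ∀ᵐ x ∂(volume.restrict (Ω : Set SobolevEq.Plane)), σ₀ ≤ σ x)
    -- source term and initial value
    (f : ℝ → SobolevEq.L2 Ω) (hf : MemLp f 2 (SobolevEq.timeMeasure T))
    (u₀ : SobolevEq.H10 Ω) :
    (∃! u : Lp (SobolevEq.H10 Ω) 2 (SobolevEq.timeMeasure T),
      SobolevEq.IsWeakSolution 1 T μ ε β σ f u₀ u) ∧
    ∀ u : Lp (SobolevEq.H10 Ω) 2 (SobolevEq.timeMeasure T),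
      SobolevEq.IsWeakSolution 1 T μ ε β σ f u₀ u →
        SobolevEq.IsWeakSolution 2 T μ ε β σ f u₀ u := by
  have hσ' : MemLp σ ∞ (volume.restrict (Ω : Set SobolevEq.Plane)) := by
    rw [funext hσ]
    exact hγ.sub (hdivβ.const_mul _)
  obtain ⟨A, R, hAR⟩ := SobolevEq.exists_evolution_operators hM hμ hε hβ hσ'
  obtain ⟨u, hu⟩ := SobolevEq.exists_isWeakSolution (u₀ := u₀) hT hAR hf
  exact ⟨⟨u, hu.mono one_le_two, fun v hv => hv.unique hT hAR (hu.mono one_le_two)⟩,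
    fun v hv => hv.sq_integrable_deriv hAR hf⟩
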